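/- **Definitions.** Let $M$ be a smooth manifold of dimension $2n+1$. An *almost paracontact structure* $(\varphi,\xi,\eta)$ on $M$ consists of a smooth $(1,1)$-tensor field $\varphi$, a smooth vector field $\xi$ (the *Reeb vector field*) and a smooth $1$-form $\eta$ with $$\varphi(\xi)=0,\qquad \eta\circ\varphi=0,\qquad \eta(\xi)=1,\qquad \varphi^2=\mathrm{Id}-\eta\otimes\xi,$$ such that the eigenspaces of $\varphi|_{\ker\eta}$ for the eigenvalues $1$ and $-1$ have equal dimension at each point. A *paracontact metric manifold* $(M,\varphi,\xi,\eta,g)$ is a smooth manifold with an almost paracontact structure and a pseudo-Riemannian metric $g$ such that, for all smooth vector fields $X,Y$, $$g(\varphi X,\varphi Y)=-g(X,Y)+\eta(X)\eta(Y),\qquad g(X,\varphi Y)=d\eta(X,Y),$$ where $d\eta(X,Y)=\tfrac12\big(X(\eta(Y))-Y(\eta(X))-\eta([X,Y])\big)$. It is *paraSasakian* if moreover it is normal, i.e. $[\varphi,\varphi]-2\,d\eta\otimes\xi=0$, where $[\varphi,\varphi](X,Y)=\varphi^2[X,Y]+[\varphi X,\varphi Y]-\varphi[\varphi X,Y]-\varphi[X,\varphi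 Y]$. Let $\nabla$ be the Levi-Civita connection of $g$. A smooth vector field $V$ is *affine Killing* if $\mathcal L_V\nabla=0$, i.e. $$[V,\nabla_XY]-\nabla_{[V,X]}Y-\nabla_X[V,Y]=0\quad\text{for all smooth vector fields }X,Y,$$ and *Killing* if $\mathcal L_Vg=0$. **Theorem.** Let $(M,\varphi,\xi,\eta,g)$ be a three-dimensional paracontact metric manifold. If the Reeb vector field $\xi$ is affine Killing, then $\xi$ is Killing, and $(M,\varphi,\xi,\eta,g)$ is paraSasakian. -/

import Mathlib

open Bundle VectorField
open scoped Manifold ContDiff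

noncomputable section

/-! Throughout, `M` is a smooth (`C^∞`) manifold without boundary of dimension `n`. -/

section Defs

variable {n : ℕ} {M : Type*} [TopologicalSpace M] [ChartedSpace (EuclideanSpace ℝ (Fin n)) M]

variable [IsManifold (𝓡 n) ∞ M]

/-- A vector field `X` on `M` is smooth. -/
def IsSmoothField (X : Π x : M, TangentSpace (𝓡 n) x) : Prop :=
  ContMDiff (𝓡 n) (𝓡 n).tangent ∞ (fun x ↦ (⟨x, X x⟩ : TangentBundle (𝓡 n) M))

variable (n M) in
/-- A pseudo-Riemannian metric: a smooth field of symmetric nondegenerate bilinear forms on the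
tangent spaces. -/
structure PseudoRiemannianMetric where
  /-- The bilinear form on each tangent space. -/
  inner (x : M) : TangentSpace (𝓡 n) x →L[ℝ] TangentSpace (𝓡 n) x →L[ℝ] ℝ
  symm (x : M) (v w : TangentSpace (𝓡 n) x) : inner x v w = inner x w v
  nondegenerate (x : M) (v : TangentSpace (𝓡 n) x) (hv : ∀ w, inner x v w = 0) : v = 0
  contMDiff : ContMDiff (𝓡 n)
    ((𝓡 n).prod 𝓘(ℝ, EuclideanSpace ℝ (Fin n) →L[ℝ] EuclideanSpace ℝ (Fin n) →L[ℝ] ℝ)) ∞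
    (fun x ↦ TotalSpace.mk' (EuclideanSpace ℝ (Fin n) →L[ℝ] EuclideanSpace ℝ (Fin n) →L[ℝ] ℝ)
      (E := fun x : M ↦ TangentSpace (𝓡 n) x →L[ℝ] TangentSpace (𝓡 n) x →L[ℝ] ℝ) x (inner x))

variable (n M) in
/-- An almost paracontact structure `(φ, ξ, η)`: a smooth `(1,1)`-tensor field, a smooth vector
field and a smooth `1`-form such that `φ ξ = 0`, `η ∘ φ = 0`, `η ξ = 1`, `φ² = Id - η ⊗ ξ`, and
such that the eigenspaces of the restriction of `φ` to `ker η` for the eigenvalues `1` and `-1`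
have equal dimension. -/
structure AlmostParacontactStructure where
  /-- The `(1,1)`-tensor field. -/
  φ (x : M) : TangentSpace (𝓡 n) x →L[ℝ] TangentSpace (𝓡 n) x
  /-- The Reeb vector field. -/
  ξ (x : M) : TangentSpace (𝓡 n) x
  /-- The `1`-form. -/
  η (x : M) : TangentSpace (𝓡 n) x →L[ℝ] ℝ
  contMDiff_φ : ContMDiff (𝓡 n)
    ((𝓡 n).prod 𝓘(ℝ, EuclideanSpace ℝ (Fin n) →L[ℝ] EuclideanSpace ℝ (Fin n))) ∞
    (fun x ↦ TotalSpace.mk' (EuclideanSpace ℝ (Fin n) →L[ℝ] EuclideanSpace ℝ (Fin n))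
      (E := fun x : M ↦ TangentSpace (𝓡 n) x →L[ℝ] TangentSpace (𝓡 n) x) x (φ x))
  contMDiff_ξ : IsSmoothField ξ
  contMDiff_η : ContMDiff (𝓡 n) ((𝓡 n).prod 𝓘(ℝ, EuclideanSpace ℝ (Fin n) →L[ℝ] ℝ)) ∞
    (fun x ↦ TotalSpace.mk' (EuclideanSpace ℝ (Fin n) →L[ℝ] ℝ)
      (E := fun x : M ↦ TangentSpace (𝓡 n) x →L[ℝ] ℝ) x (η x))
  φ_ξ (x : M) : φ x (ξ x) = 0
  η_φ (x : M) (v : TangentSpace (𝓡 n) x) : η x (φ x v) = 0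
  η_ξ (x : M) : η x (ξ x) = 1
  φ_φ (x : M) (v : TangentSpace (𝓡 n) x) : φ x (φ x v) = v - η x v • ξ x
  finrank_eigenspace (x : M) :
    Module.finrank ℝ ↥((η x).toLinearMap.ker ⊓ Module.End.eigenspace (φ x).toLinearMap (1 : ℝ)) =
    Module.finrank ℝ ↥((η x).toLinearMap.ker ⊓ Module.End.eigenspace (φ x).toLinearMap (-1 : ℝ))

/-- The value at `x` of `dη(X, Y) = ½ (X(η(Y)) - Y(η(X)) - η([X, Y]))`, the exterior derivative of
the `1`-form `η` evaluated on the vector fields `X` and `Y` (normalised with the factor `½`). -/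
def oneFormExtDeriv (η : Π x : M, TangentSpace (𝓡 n) x →L[ℝ] ℝ)
    (X Y : Π x : M, TangentSpace (𝓡 n) x) (x : M) : ℝ :=
  (1 / 2 : ℝ) * (mvfderiv (𝓡 n) (fun y ↦ η y (Y y)) x (X x)
    - mvfderiv (𝓡 n) (fun y ↦ η y (X y)) x (Y x)
    - η x (mlieBracket (𝓡 n) X Y x))

/-- The Nijenhuis torsion
`[φ, φ](X, Y) = φ²[X, Y] + [φX, φY] - φ[φX, Y] - φ[X, φY]` of a `(1,1)`-tensor field. -/
def nijenhuisTorsion (φ : Π x : M, TangentSpace (𝓡 n) x →L[ℝ] TangentSpace (𝓡 n) x)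
    (X Y : Π x : M, TangentSpace (𝓡 n) x) (x : M) : TangentSpace (𝓡 n) x :=
  φ x (φ x (mlieBracket (𝓡 n) X Y x))
    + mlieBracket (𝓡 n) (fun y ↦ φ y (X y)) (fun y ↦ φ y (Y y)) x
    - φ x (mlieBracket (𝓡 n) (fun y ↦ φ y (X y)) Y x)
    - φ x (mlieBracket (𝓡 n) X (fun y ↦ φ y (Y y)) x)

/-- `(φ, ξ, η, g)` is an almost paracontact metric structure:
`g(φX, φY) = -g(X, Y) + η(X) η(Y)`. -/
def IsCompatibleMetric (S : AlmostParacontactStructure n M) (g : PseudoRiemannianMetric n M) :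
    Prop :=
  ∀ (x : M) (v w : TangentSpace (𝓡 n) x),
    g.inner x (S.φ x v) (S.φ x w) = - g.inner x v w + S.η x v * S.η x w

/-- `(φ, ξ, η, g)` is a paracontact metric structure: `g` is compatible with `(φ, ξ, η)`, and the
fundamental `2`-form `Φ(X, Y) = g(X, φY)` is `dη`. -/
structure IsParacontactMetric (S : AlmostParacontactStructure n M)
    (g : PseudoRiemannianMetric n M) : Prop where
  compatible : IsCompatibleMetric S g
  fundamentalForm_eq : ∀ X Y : Π x : M, TangentSpace (𝓡 n) x,
    IsSmoothField X → IsSmoothField Y → ∀ x : M,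
      g.inner x (X x) (S.φ x (Y x)) = oneFormExtDeriv S.η X Y x

/-- An almost paracontact structure is normal: `[φ, φ] - 2 dη ⊗ ξ = 0`. -/
def AlmostParacontactStructure.IsNormal (S : AlmostParacontactStructure n M) : Prop :=
  ∀ X Y : Π x : M, TangentSpace (𝓡 n) x, IsSmoothField X → IsSmoothField Y → ∀ x : M,
    nijenhuisTorsion S.φ X Y x - (2 * oneFormExtDeriv S.η X Y x) • S.ξ x = 0

/-- A paraSasakian structure is a normal paracontact metric structure. -/
structure IsParaSasakian (S : AlmostParacontactStructure n M)
    (g : PseudoRiemannianMetric n M) : Prop where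
  paracontactMetric : IsParacontactMetric S g
  normal : S.IsNormal

/-- The vector field `V` is Killing: `(L_V g)(X, Y) = V(g(X, Y)) - g([V, X], Y) - g(X, [V, Y])`
vanishes for all smooth vector fields `X`, `Y`. -/
def IsKilling (g : PseudoRiemannianMetric n M) (V : Π x : M, TangentSpace (𝓡 n) x) : Prop :=
  ∀ X Y : Π x : M, TangentSpace (𝓡 n) x, IsSmoothField X → IsSmoothField Y → ∀ x : M,
    mvfderiv (𝓡 n) (fun y ↦ g.inner y (X y) (Y y)) x (V x)
      - g.inner x (mlieBracket (𝓡 n) V X x) (Y x)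
      - g.inner x (X x) (mlieBracket (𝓡 n) V Y x) = 0

variable (n M) in
/-- Affine connections on `M`. For `D : AffineConnection n M`, the value of `∇_X Y` at `x` is
`D Y x (X x)`. -/
abbrev AffineConnection : Type _ :=
  CovariantDerivative (𝓡 n) (EuclideanSpace ℝ (Fin n)) (TangentSpace (𝓡 n) : M → Type _)

/-- The connection `D` is the Levi-Civita connection of `g`: it is smooth, torsion-free
(`∇_X Y - ∇_Y X = [X, Y]`) and metric (`X(g(Y, Z)) = g(∇_X Y, Z) + g(Y, ∇_X Z)`). -/
structure IsLeviCivita (g : PseudoRiemannianMetric n M) (D : AffineConnection n M) : Prop where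
  smooth : D.ContMDiffCovariantDerivative ∞
  torsion_free : D.torsion = 0
  metric : ∀ (Y Z : Π x : M, TangentSpace (𝓡 n) x) (x : M) (v : TangentSpace (𝓡 n) x),
    MDifferentiableAt (𝓡 n) (𝓡 n).tangent (fun y ↦ (⟨y, Y y⟩ : TangentBundle (𝓡 n) M)) x →
    MDifferentiableAt (𝓡 n) (𝓡 n).tangent (fun y ↦ (⟨y, Z y⟩ : TangentBundle (𝓡 n) M)) x →
      mvfderiv (𝓡 n) (fun y ↦ g.inner y (Y y) (Z y)) x v =
        g.inner x (D Y x v) (Z x) + g.inner x (Y x) (D Z x v)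

/-- The Lie derivative of a connection,
`(L_V ∇)(X, Y) = [V, ∇_X Y] - ∇_{[V, X]} Y - ∇_X [V, Y]`. -/
def connectionLieDeriv (V : Π x : M, TangentSpace (𝓡 n) x) (D : AffineConnection n M)
    (X Y : Π x : M, TangentSpace (𝓡 n) x) (x : M) : TangentSpace (𝓡 n) x :=
  mlieBracket (𝓡 n) V (fun y ↦ D Y y (X y)) x
    - D Y x (mlieBracket (𝓡 n) V X x)
    - D (mlieBracket (𝓡 n) V Y) x (X x)

/-- `V` is affine Killing with respect to the connection `∇`: `L_V ∇ = 0`. -/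
def IsAffineKilling (D : AffineConnection n M) (V : Π x : M, TangentSpace (𝓡 n) x) : Prop :=
  ∀ X Y : Π x : M, TangentSpace (𝓡 n) x, IsSmoothField X → IsSmoothField Y → ∀ x : M,
    connectionLieDeriv V D X Y x = 0

end Defs

end

/-! Write A = ∇ξ and B = A + φ. The condition g(X, φY) = dη(X, Y) says that the skew part of A is
-φ, so B is symmetric and g(B·, ·) is half of L_ξ g. Applying L_ξ∇ = 0 to the pairs (X, ξ) and (X,
φW) gives (L_ξ g)(AX, φW) = 0, and from this BA = 0, that is, B² = Bφ. Taking adjoints, B² = -φB.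
The first relation yields B³ = Bφ² = B, both together yield B³ = -B³, so B = 0 and ∇ξ = -φ
(`IsParacontactForm.eq_neg_φ`). This part works in every dimension. As φ is skew, ξ is Killing.

Normality uses dimension three. There ker η is a plane, and the skew endomorphism ∇_vφ vanishes as a
form on it, so it is determined by (∇_vφ)ξ = φ²v (`IsParacontactForm.skew_apply_eq`). The resulting
formula for ∇φ, put into the Nijenhuis torsion, leaves exactly 2 dη ⊗ ξ. -/

/-! ### Linear algebra on a single tangent space -/

section LinearAlgebra

variable {V : Type*} [AddCommGroup V] [Module ℝ V]

/-- The linear-algebraic data that a paracontact metric structure induces on a tangent space. -/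
structure IsParacontactForm (G : V →ₗ[ℝ] V →ₗ[ℝ] ℝ) (φ : V →ₗ[ℝ] V) (ξ : V) (η : V →ₗ[ℝ] ℝ) :
    Prop where
  symm : ∀ v w, G v w = G w v
  nondegenerate : ∀ v, (∀ w, G v w = 0) → v = 0
  φ_ξ : φ ξ = 0
  η_φ : ∀ v, η (φ v) = 0
  η_ξ : η ξ = 1
  φ_φ : ∀ v, φ (φ v) = v - η v • ξ
  compatible : ∀ v w, G (φ v) (φ w) = - G v w + η v * η w

namespace IsParacontactForm

variable {G : V →ₗ[ℝ] V →ₗ[ℝ] ℝ} {φ : V →ₗ[ℝ] V} {ξ : V} {η : V →ₗ[ℝ] ℝ}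

lemma eq_of_forall (h : IsParacontactForm G φ ξ η) {v w : V} (hvw : ∀ u, G v u = G w u) :
    v = w :=
  sub_eq_zero.1 (h.nondegenerate _ fun u ↦ by simp [hvw u])

lemma apply_ξ_left (h : IsParacontactForm G φ ξ η) (v : V) : G ξ v = η v := by
  have := h.compatible ξ v
  simp only [h.φ_ξ, h.η_ξ, map_zero, LinearMap.zero_apply] at this
  linarith

lemma apply_ξ_right (h : IsParacontactForm G φ ξ η) (v : V) : G v ξ = η v := by
  rw [h.symm, h.apply_ξ_left]

lemma skew (h : IsParacontactForm G φ ξ η) (v w : V) : G (φ v) w = - G v (φ w) := by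
  have := h.compatible (φ v) w
  rw [h.φ_φ, h.η_φ] at this
  simp only [map_sub, map_smul, LinearMap.sub_apply, LinearMap.smul_apply, h.apply_ξ_left,
    h.η_φ, smul_eq_mul] at this
  linarith

lemma eq_φ_φ_add (h : IsParacontactForm G φ ξ η) (v : V) : v = φ (φ v) + η v • ξ := by
  rw [h.φ_φ]; abel

/-- An endomorphism `A` whose skew part is `-φ`, which kills `ξ`, and whose range is in the kernel
of its symmetric part, is `-φ`. -/
lemma eq_neg_φ (h : IsParacontactForm G φ ξ η) {A : V →ₗ[ℝ] V}
    (hskew : ∀ v w, G (A v) w - G (A w) v = 2 * G v (φ w)) (hξ : A ξ = 0)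
    (hη : ∀ v, η (A v) = 0)
    (hA : ∀ v w, G (A (A v)) (φ w) + G (A v) (A (φ w)) = 0) (v : V) : A v = - φ v := by
  -- The range of φ and ξ span everything, and both terms vanish at w = ξ.
  have hA' (v w) : G (A (A v)) w + G (A v) (A w) = 0 := by
    rw [h.eq_φ_φ_add w]
    simp only [map_add, map_smul, hξ, h.apply_ξ_right, hη]
    simpa using hA v (φ w)
  set B : V →ₗ[ℝ] V := A + φ
  have Bdef (v) : B v = A v + φ v := rfl
  have hsymm (v w) : G (B v) w = G v (B w) := by
    have h1 := hskew v w
    have h2 := h.skew v w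
    have h3 := h.symm (A w) v
    simp only [Bdef, map_add, LinearMap.add_apply]
    linarith
  have hBA (v) : B (A v) = 0 := h.nondegenerate _ fun w ↦ by
    have h1 := hskew (A v) w
    have h2 := h.skew (A v) w
    have h3 := h.symm (A w) (A v)
    have h4 := hA' v w
    simp only [Bdef, map_add, LinearMap.add_apply]
    linarith
  have hBB (v) : B (B v) = B (φ v) := by
    conv_lhs => rw [Bdef v, map_add, hBA, zero_add]
  -- The adjoint of B² = Bφ, for B symmetric and φ skew.
  have hBB' (v) : B (B v) = - φ (B v) := h.eq_of_forall fun w ↦ by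
    rw [hsymm, hsymm, hBB, ← hsymm, map_neg, LinearMap.neg_apply, h.skew, neg_neg]
  have hBξ : B ξ = 0 := by rw [Bdef, hξ, h.φ_ξ, add_zero]
  have h3 (v) : B (B (B v)) = B v := by
    rw [hBB v, hBB (φ v), h.φ_φ, map_sub, map_smul, hBξ, smul_zero, sub_zero]
  have h4 (v) : B (B (B v)) = - B (B (B v)) := by
    conv_lhs => rw [hBB (B v), ← neg_neg (φ (B v)), ← hBB', map_neg]
  have h5 : B v = 0 := by
    have : IsAddTorsionFree V := .of_isTorsionFree ℝ V
    rw [← h3, self_eq_neg.1 (h4 v)]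
  rw [Bdef] at h5
  exact eq_neg_of_add_eq_zero_left h5

/-- Otherwise polarization puts ker η in the radical of G, so η is injective on a space of dimension
three. -/
lemma exists_apply_self_ne_zero (h : IsParacontactForm G φ ξ η) (hV : Module.finrank ℝ V = 3) :
    ∃ e, η e = 0 ∧ G e e ≠ 0 := by
  by_contra! H
  have : FiniteDimensional ℝ V := Module.finite_of_finrank_pos (by omega)
  have hpol (e f) (he : η e = 0) (hf : η f = 0) : G e f = 0 := by
    have h1 := H (e + f) (by simp [he, hf])
    simp only [map_add, LinearMap.add_apply, H e he, H f hf, h.symm f e] at h1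
    linarith
  have hker (e) (he : η e = 0) : e = 0 := h.nondegenerate _ fun w ↦ by
    rw [h.eq_φ_φ_add w, map_add, map_smul, h.apply_ξ_right, he, hpol e _ he (h.η_φ _)]
    simp
  have hinj : Function.Injective η := (injective_iff_map_eq_zero η).2 hker
  have := LinearMap.finrank_le_finrank_of_injective hinj
  simp [hV] at this

/-- For e non-null in ker η, the vectors e, φe, ξ are pairwise orthogonal and non-null, hence a
basis. -/
lemma exists_frame (h : IsParacontactForm G φ ξ η) (hV : Module.finrank ℝ V = 3) :
    ∃ e, η e = 0 ∧ ∀ v, η v = 0 → ∃ a b : ℝ, v = a • e + b • φ e := by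
  obtain ⟨e, he, hee⟩ := h.exists_apply_self_ne_zero hV
  have : FiniteDimensional ℝ V := Module.finite_of_finrank_pos (by omega)
  have h0 : G e (φ e) = 0 := by
    have h1 := h.skew e e
    rw [h.symm] at h1
    linarith
  have h1 : G (φ e) (φ e) = - G e e := by rw [h.compatible, he]; ring
  have hli : LinearIndependent ℝ ![e, φ e, ξ] := by
    rw [Fintype.linearIndependent_iff]
    intro c hc
    simp only [Fin.sum_univ_three, Matrix.cons_val_zero, Matrix.cons_val_one,
      Matrix.cons_val] at hc
    have k1 := congr(G e $hc)
    have k2 := congr(G (φ e) $hc)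
    have k3 := congr(η $hc)
    simp only [map_add, map_smul, h0, h.symm (φ e) e, h1, h.apply_ξ_right, he, h.η_φ, h.η_ξ,
      map_zero, smul_eq_mul, mul_zero, add_zero, zero_add, mul_one] at k1 k2 k3
    intro i
    fin_cases i
    · simpa [hee] using k1
    · simpa [hee] using k2
    · simpa using k3
  have hspan := hli.span_eq_top_of_card_eq_finrank (by simp [hV])
  refine ⟨e, he, fun v hv ↦ ?_⟩
  have hvs : v ∈ Submodule.span ℝ (Set.range ![e, φ e, ξ]) := by rw [hspan]; trivial
  obtain ⟨c, hc⟩ := (Submodule.mem_span_range_iff_exists_fun ℝ).1 hvs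
  simp only [Fin.sum_univ_three, Matrix.cons_val_zero, Matrix.cons_val_one,
      Matrix.cons_val] at hc
  have k3 := congr(η $hc)
  simp only [map_add, map_smul, he, h.η_φ, h.η_ξ, hv, smul_eq_mul, mul_zero, zero_add,
    mul_one] at k3
  exact ⟨c 0, c 1, by rw [← hc, k3, zero_smul, add_zero]⟩

/-- In dimension three, a skew endomorphism `Q` with `G(Q e, φ e) = 0` for `e ∈ ker η` is
determined by `Q ξ`. -/
lemma skew_apply_eq (h : IsParacontactForm G φ ξ η) (hV : Module.finrank ℝ V = 3)
    {Q : V →ₗ[ℝ] V} (hskew : ∀ v w, G (Q v) w = - G v (Q w))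
    (hφ : ∀ w, G (Q (φ w)) (φ (φ w)) = 0) (v : V) :
    Q v = - G (Q ξ) v • ξ + η v • Q ξ := by
  have hself (v) : G (Q v) v = 0 := by
    have h1 := hskew v v
    rw [h.symm v] at h1
    linarith
  obtain ⟨e, he, hspan⟩ := h.exists_frame hV
  have h1 : G (Q e) (φ e) = 0 := by
    simpa [h.φ_φ, he] using hφ (φ e)
  have h2 : G (Q (φ e)) e = 0 := by rw [hskew, h.symm, h1, neg_zero]
  -- On the plane spanned by e and φe, the alternating form G(Q·, ·) has the single coefficient
  -- G(Qe, φe), which is zero.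
  have hker (v w) (hv : η v = 0) (hw : η w = 0) : G (Q v) w = 0 := by
    obtain ⟨a, b, rfl⟩ := hspan v hv
    obtain ⟨c, d, rfl⟩ := hspan w hw
    simp [h1, h2, hself]
  have hQξ : η (Q ξ) = 0 := by rw [← h.apply_ξ_right, hself]
  refine h.eq_of_forall fun w ↦ ?_
  have e1 : G (Q v) w = G (Q (φ (φ v))) (φ (φ w)) + η w * G (Q v) ξ + η v * G (Q ξ) w := by
    conv_lhs => rw [h.eq_φ_φ_add v]
    conv_rhs => rw [h.eq_φ_φ_add v]
    conv_lhs => rw [h.eq_φ_φ_add w]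
    conv_rhs => rw [h.eq_φ_φ_add w]
    simp [h.φ_φ, h.apply_ξ_right, hQξ]
    ring
  rw [e1, hker _ _ (h.η_φ _) (h.η_φ _), hskew v ξ, h.symm v]
  simp [h.apply_ξ_left]
  ring

end IsParacontactForm

end LinearAlgebra

noncomputable section

/-! ### The Levi-Civita derivative of the Reeb field -/

section Fields

variable {n : ℕ} {M : Type*} [TopologicalSpace M] [ChartedSpace (EuclideanSpace ℝ (Fin n)) M]
  [IsManifold (𝓡 n) ∞ M]

/-- A local extension is cut off by a bump function, hence the Hausdorff assumption. This turns
identities between smooth fields into identities between tangent vectors. -/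
lemma exists_isSmoothField_apply_eq [T2Space M] (x : M) (v : TangentSpace (𝓡 n) x) :
    ∃ X : Π x : M, TangentSpace (𝓡 n) x, IsSmoothField X ∧ X x = v := by
  obtain ⟨s, hs, hsmooth⟩ := FiberBundle.exists_contMDiffOn_extend (𝓡 n) (k := ∞)
    (EuclideanSpace ℝ (Fin n)) v
  obtain ⟨f, -, hf⟩ := (SmoothBumpFunction.nhds_basis_tsupport (I := 𝓡 n) x).mem_iff.1
    (interior_mem_nhds.2 hs)
  refine ⟨(f : M → ℝ) • FiberBundle.extend (EuclideanSpace ℝ (Fin n)) v, ?_, by simp⟩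
  exact ContMDiffOn.smul_section_of_tsupport f.contMDiff.contMDiffOn isOpen_interior hf
    (hsmooth.mono interior_subset)

variable {X Y Z : Π x : M, TangentSpace (𝓡 n) x}

/-- A vector field is differentiable at a point. -/
abbrev IsDifferentiableFieldAt (X : Π x : M, TangentSpace (𝓡 n) x) (x : M) : Prop :=
  MDifferentiableAt (𝓡 n) (𝓡 n).tangent (fun y ↦ (⟨y, X y⟩ : TangentBundle (𝓡 n) M)) x

lemma IsSmoothField.mdifferentiableAt (hX : IsSmoothField X) (x : M) :
    IsDifferentiableFieldAt X x :=
  (hX x).mdifferentiableAt (by simp)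

variable {S : AlmostParacontactStructure n M} {g : PseudoRiemannianMetric n M}
  {D : AffineConnection n M}

namespace AlmostParacontactStructure

lemma isSmoothField_φ (S : AlmostParacontactStructure n M) (hX : IsSmoothField X) :
    IsSmoothField (fun y ↦ S.φ y (X y)) :=
  S.contMDiff_φ.clm_bundle_apply hX

lemma mdifferentiableAt_φ (S : AlmostParacontactStructure n M) {x : M}
    (hX : IsDifferentiableFieldAt X x) :
    IsDifferentiableFieldAt (fun y ↦ S.φ y (X y)) x :=
  ((S.contMDiff_φ x).mdifferentiableAt (by simp)).clm_bundle_apply hX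

end AlmostParacontactStructure

/-- The metric at a point as a bilinear form. -/
def PseudoRiemannianMetric.form (g : PseudoRiemannianMetric n M) (x : M) :
    TangentSpace (𝓡 n) x →ₗ[ℝ] TangentSpace (𝓡 n) x →ₗ[ℝ] ℝ :=
  ContinuousLinearMap.toLinearMap₁₂ (g.inner x)

lemma IsCompatibleMetric.isParacontactForm (h : IsCompatibleMetric S g) (x : M) :
    IsParacontactForm (g.form x) (S.φ x).toLinearMap (S.ξ x) (S.η x).toLinearMap where
  symm := g.symm x
  nondegenerate := g.nondegenerate x
  φ_ξ := S.φ_ξ x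
  η_φ := S.η_φ x
  η_ξ := S.η_ξ x
  φ_φ := S.φ_φ x
  compatible := h x

lemma IsCompatibleMetric.inner_ξ_left (h : IsCompatibleMetric S g) (x : M)
    (v : TangentSpace (𝓡 n) x) : g.inner x (S.ξ x) v = S.η x v :=
  (h.isParacontactForm x).apply_ξ_left v

lemma IsCompatibleMetric.inner_ξ_right (h : IsCompatibleMetric S g) (x : M)
    (v : TangentSpace (𝓡 n) x) : g.inner x v (S.ξ x) = S.η x v :=
  (h.isParacontactForm x).apply_ξ_right v

lemma IsCompatibleMetric.inner_φ_left (h : IsCompatibleMetric S g) (x : M)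
    (v w : TangentSpace (𝓡 n) x) : g.inner x (S.φ x v) w = - g.inner x v (S.φ x w) :=
  (h.isParacontactForm x).skew v w

namespace IsLeviCivita

lemma isSmoothField_apply (hD : IsLeviCivita g D) (hX : IsSmoothField X) (hY : IsSmoothField Y) :
    IsSmoothField (fun y ↦ D Y y (X y)) := by
  have h := hD.smooth.contMDiff.contMDiff (σ := Y) (ContMDiff.contMDiffOn hY)
  exact ContMDiff.clm_bundle_apply (contMDiffOn_univ.1 h) hX

lemma mlieBracket_eq (hD : IsLeviCivita g D) {x : M} (hX : IsDifferentiableFieldAt X x)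
    (hY : IsDifferentiableFieldAt Y x) :
    mlieBracket (𝓡 n) X Y x = D Y x (X x) - D X x (Y x) :=
  ((CovariantDerivative.torsion_eq_zero_iff D).1 hD.torsion_free hX hY).symm

/-- Smoothness is read off from [X, Y] = ∇_X Y - ∇_Y X. -/
lemma isSmoothField_mlieBracket (hD : IsLeviCivita g D) (hX : IsSmoothField X)
    (hY : IsSmoothField Y) : IsSmoothField (mlieBracket (𝓡 n) X Y) := by
  have h : mlieBracket (𝓡 n) X Y = fun y ↦ D Y y (X y) - D X y (Y y) := by
    ext1 y
    exact hD.mlieBracket_eq (hX.mdifferentiableAt y) (hY.mdifferentiableAt y)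
  rw [h]
  exact ContMDiff.sub_section (hD.isSmoothField_apply hX hY) (hD.isSmoothField_apply hY hX)

/-- Differentiating a constant inner product. -/
lemma inner_add_inner_eq_zero (hD : IsLeviCivita g D) {x : M} (hY : IsDifferentiableFieldAt Y x)
    (hZ : IsDifferentiableFieldAt Z x) {c : ℝ} (hc : ∀ y, g.inner y (Y y) (Z y) = c)
    (v : TangentSpace (𝓡 n) x) :
    g.inner x (D Y x v) (Z x) + g.inner x (Y x) (D Z x v) = 0 := by
  rw [← hD.metric Y Z x v hY hZ, funext hc, mvfderiv_const]
  rfl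

/-- ξ has constant length: g(ξ, ξ) = 1. -/
lemma η_covariantDerivative_ξ (hD : IsLeviCivita g D)
    (hS : IsCompatibleMetric S g) (x : M) (v : TangentSpace (𝓡 n) x) :
    S.η x (D S.ξ x v) = 0 := by
  have hξ := S.contMDiff_ξ.mdifferentiableAt x
  have h := hD.inner_add_inner_eq_zero hξ hξ
    (c := 1) (fun y ↦ by rw [hS.inner_ξ_left, S.η_ξ]) v
  rw [hS.inner_ξ_left, hS.inner_ξ_right] at h
  linarith

lemma mvfderiv_η (hD : IsLeviCivita g D)
    (hS : IsCompatibleMetric S g) {x : M}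
    (hX : IsDifferentiableFieldAt X x) (v : TangentSpace (𝓡 n) x) :
    mvfderiv (𝓡 n) (fun y ↦ S.η y (X y)) x v =
      g.inner x (D S.ξ x v) (X x) + S.η x (D X x v) := by
  rw [← hS.inner_ξ_left, ← hD.metric _ _ x v (S.contMDiff_ξ.mdifferentiableAt x) hX]
  simp_rw [hS.inner_ξ_left]

/-- Since η = g(ξ, ·), expanding dη with the torsion-free metric connection leaves only the skew
part of ∇ξ. -/
lemma inner_covariantDerivative_ξ_sub [T2Space M] (hD : IsLeviCivita g D)
    (hS : IsParacontactMetric S g) (x : M)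
    (v w : TangentSpace (𝓡 n) x) :
    g.inner x (D S.ξ x v) w - g.inner x (D S.ξ x w) v = 2 * g.inner x v (S.φ x w) := by
  obtain ⟨X, hX, rfl⟩ := exists_isSmoothField_apply_eq x v
  obtain ⟨Y, hY, rfl⟩ := exists_isSmoothField_apply_eq x w
  have hX' := hX.mdifferentiableAt x
  have hY' := hY.mdifferentiableAt x
  rw [hS.fundamentalForm_eq X Y hX hY, oneFormExtDeriv, hD.mvfderiv_η hS.compatible hX',
    hD.mvfderiv_η hS.compatible hY', hD.mlieBracket_eq hX' hY', map_sub]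
  ring

lemma covariantDerivative_ξ_ξ [T2Space M] (hD : IsLeviCivita g D)
    (hS : IsParacontactMetric S g) (x : M) :
    D S.ξ x (S.ξ x) = 0 := by
  refine g.nondegenerate x _ fun w ↦ ?_
  have h := hD.inner_covariantDerivative_ξ_sub hS x (S.ξ x) w
  rw [hS.compatible.inner_ξ_right, hS.compatible.inner_ξ_left, S.η_φ,
    hD.η_covariantDerivative_ξ hS.compatible] at h
  linarith

/-- The Lie derivative of the metric along an affine Killing Reeb field vanishes when one argument
is in the image of `∇ξ` and the other in the image of `φ`. -/
lemma inner_covariantDerivative_ξ_of_isAffineKilling [T2Space M] (hD : IsLeviCivita g D)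
    (hS : IsParacontactMetric S g)
    (hξ : IsAffineKilling D S.ξ) (x : M) (v w : TangentSpace (𝓡 n) x) :
    g.inner x (D S.ξ x (D S.ξ x v)) (S.φ x w) +
      g.inner x (D S.ξ x v) (D S.ξ x (S.φ x w)) = 0 := by
  obtain ⟨X, hX, rfl⟩ := exists_isSmoothField_apply_eq x v
  obtain ⟨W, hW, rfl⟩ := exists_isSmoothField_apply_eq x w
  have hc := hS.compatible
  have hξs := S.contMDiff_ξ
  set Z : Π x : M, TangentSpace (𝓡 n) x := fun y ↦ S.φ y (W y)
  have hZ : IsSmoothField Z := S.isSmoothField_φ hW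
  have hAX : IsSmoothField (fun y ↦ D S.ξ y (X y)) := hD.isSmoothField_apply hX hξs
  have hU : IsSmoothField (fun y ↦ D Z y (X y)) := hD.isSmoothField_apply hX hZ
  have hL : IsSmoothField (mlieBracket (𝓡 n) S.ξ Z) := hD.isSmoothField_mlieBracket hξs hZ
  -- A field orthogonal to `ξ` has covariant derivative with `η`-component given by `∇ξ`.
  have key {T : Π x : M, TangentSpace (𝓡 n) x} (hT : IsSmoothField T)
      (hT0 : ∀ y, S.η y (T y) = 0) (y : M) (u : TangentSpace (𝓡 n) y) :
      S.η y (D T y u) = - g.inner y (D S.ξ y u) (T y) := by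
    have h := hD.inner_add_inner_eq_zero (hξs.mdifferentiableAt y) (hT.mdifferentiableAt y)
      (c := 0) (fun y ↦ by rw [hc.inner_ξ_left, hT0]) u
    rw [hc.inner_ξ_left] at h
    linarith
  have hη {T : Π x : M, TangentSpace (𝓡 n) x} (hT : IsSmoothField T) (y : M) :
      S.η y (mlieBracket (𝓡 n) S.ξ T y) = S.η y (D T y (S.ξ y)) := by
    rw [hD.mlieBracket_eq (hξs.mdifferentiableAt y) (hT.mdifferentiableAt y), map_sub,
      hD.η_covariantDerivative_ξ hc, sub_zero]
  have hZ0 (y : M) : S.η y (Z y) = 0 := S.η_φ y _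
  have hL0 (y : M) : S.η y (mlieBracket (𝓡 n) S.ξ Z y) = 0 := by
    rw [hη hZ, key hZ hZ0, hD.covariantDerivative_ξ_ξ hS]
    simp
  -- As [ξ, ξ] = 0, this reads ∇_ξ(AX) - A(AX) - A[ξ, X] = 0 with A = ∇ξ.
  have h1 := hξ X S.ξ hX hξs x
  rw [connectionLieDeriv, mlieBracket_self, CovariantDerivative.zero,
    hD.mlieBracket_eq (hξs.mdifferentiableAt x) (hAX.mdifferentiableAt x)] at h1
  have h2 := congr(S.η x $(hξ X Z hX hZ x))
  rw [connectionLieDeriv, map_sub, map_sub, hη hU, key hZ hZ0, key hL hL0, map_zero] at h2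
  -- Differentiate η(∇_X Z) = -g(AX, Z) along ξ; no extra term appears because ∇_ξ ξ = 0.
  have h3 : S.η x (D (fun y ↦ D Z y (X y)) x (S.ξ x)) =
      - (g.inner x (D (fun y ↦ D S.ξ y (X y)) x (S.ξ x)) (Z x) +
        g.inner x (D S.ξ x (X x)) (D Z x (S.ξ x))) := by
    have e1 := hD.mvfderiv_η hc (hU.mdifferentiableAt x) (S.ξ x)
    have e2 := hD.metric _ _ x (S.ξ x) (hAX.mdifferentiableAt x) (hZ.mdifferentiableAt x)
    rw [hD.covariantDerivative_ξ_ξ hS, map_zero, zero_apply, zero_add] at e1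
    rw [← e1, ← e2]
    simp_rw [key hZ hZ0, mvfderiv_fun_neg]
    rfl
  -- Pairing the first identity with Z and inserting [ξ, Z] = ∇_ξ Z - AZ in the second makes all
  -- derivatives along ξ cancel.
  have h4 := congr(g.inner x $h1 (Z x))
  rw [h3, hD.mlieBracket_eq (Y := Z) (hξs.mdifferentiableAt x) (hZ.mdifferentiableAt x)] at h2
  simp only [map_sub, sub_apply, map_zero, zero_apply,
    Pi.zero_apply, sub_zero] at h4 h2
  linarith

/-- If the Reeb vector field is affine Killing, then `∇ξ = -φ`. -/
lemma covariantDerivative_ξ_of_isAffineKilling [T2Space M] (hD : IsLeviCivita g D)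
    (hS : IsParacontactMetric S g)
    (hξ : IsAffineKilling D S.ξ) (x : M) (v : TangentSpace (𝓡 n) x) :
    D S.ξ x v = - S.φ x v :=
  (hS.compatible.isParacontactForm x).eq_neg_φ (A := (D S.ξ x).toLinearMap)
    (hD.inner_covariantDerivative_ξ_sub hS x) (hD.covariantDerivative_ξ_ξ hS x)
    (hD.η_covariantDerivative_ξ hS.compatible x)
    (hD.inner_covariantDerivative_ξ_of_isAffineKilling hS hξ x) v

lemma isKilling_of_covariantDerivative_ξ (hD : IsLeviCivita g D)
    (hS : IsCompatibleMetric S g)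
    (hA : ∀ x v, D S.ξ x v = - S.φ x v) : IsKilling g S.ξ := by
  intro X Y hX hY x
  have hξ := S.contMDiff_ξ.mdifferentiableAt x
  have hX' := hX.mdifferentiableAt x
  have hY' := hY.mdifferentiableAt x
  rw [hD.metric _ _ _ _ hX' hY', hD.mlieBracket_eq hξ hX', hD.mlieBracket_eq hξ hY', hA, hA]
  simp only [map_sub, map_neg, sub_apply, neg_apply,
    hS.inner_φ_left]
  ring

end IsLeviCivita

end Fields

/-! ### The covariant derivative of φ, and normality -/

section CovariantDerivativeOfEndomorphism

variable {n : ℕ} {M : Type*} [TopologicalSpace M] [ChartedSpace (EuclideanSpace ℝ (Fin n)) M]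
  [IsManifold (𝓡 n) ∞ M] {X Y Z : Π x : M, TangentSpace (𝓡 n) x}
  {S : AlmostParacontactStructure n M} {g : PseudoRiemannianMetric n M}
  {D : AffineConnection n M}

/-- The two Leibniz terms df(v) φσ cancel, so ∇_vφ is an endomorphism of the tangent space, to which
the pointwise algebra applies. -/
lemma AlmostParacontactStructure.tensorialAt_covariantDerivative_φ
    (S : AlmostParacontactStructure n M) (D : AffineConnection n M) (x : M)
    (v : TangentSpace (𝓡 n) x) :
    TensorialAt (𝓡 n) (EuclideanSpace ℝ (Fin n))
      (fun Y : Π x : M, TangentSpace (𝓡 n) x ↦ D (fun y ↦ S.φ y (Y y)) x v - S.φ x (D Y x v)) x where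
  smul {f σ} hf hσ := by
    have h1 : (fun y ↦ S.φ y ((f • σ) y)) = f • fun y ↦ S.φ y (σ y) := by
      ext1 y
      exact map_smul (S.φ y) (f y) (σ y)
    rw [h1, D.isCovariantDerivativeOn.leibniz hσ hf,
      D.isCovariantDerivativeOn.leibniz (S.mdifferentiableAt_φ hσ) hf]
    simp only [add_apply, smul_apply, ContinuousLinearMap.smulRight_apply, map_add, map_smul,
      smul_sub]
    abel
  add {σ σ'} hσ hσ' := by
    have h1 : (fun y ↦ S.φ y ((σ + σ') y)) = (fun y ↦ S.φ y (σ y)) + fun y ↦ S.φ y (σ' y) := by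
      ext1 y
      exact map_add (S.φ y) (σ y) (σ' y)
    rw [h1, D.isCovariantDerivativeOn.add hσ hσ',
      D.isCovariantDerivativeOn.add (S.mdifferentiableAt_φ hσ) (S.mdifferentiableAt_φ hσ')]
    simp only [add_apply, map_add]
    abel

/-- The covariant derivative `∇_v φ`. -/
def AlmostParacontactStructure.covariantDerivativeφ
    (S : AlmostParacontactStructure n M) (D : AffineConnection n M) (x : M)
    (v : TangentSpace (𝓡 n) x) : TangentSpace (𝓡 n) x →L[ℝ] TangentSpace (𝓡 n) x :=
  TensorialAt.mkHom _ x (S.tensorialAt_covariantDerivative_φ D x v)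

lemma AlmostParacontactStructure.covariantDerivativeφ_apply
    (S : AlmostParacontactStructure n M) (D : AffineConnection n M) {x : M}
    (v : TangentSpace (𝓡 n) x) (hY : IsDifferentiableFieldAt Y x) :
    S.covariantDerivativeφ D x v (Y x) = D (fun y ↦ S.φ y (Y y)) x v - S.φ x (D Y x v) :=
  TensorialAt.mkHom_apply (S.tensorialAt_covariantDerivative_φ D x v) hY

namespace IsLeviCivita

/-- Differentiate φξ = 0. -/
lemma covariantDerivativeφ_ξ (hA : ∀ x v, D S.ξ x v = - S.φ x v) (x : M)
    (v : TangentSpace (𝓡 n) x) :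
    S.covariantDerivativeφ D x v (S.ξ x) = S.φ x (S.φ x v) := by
  have h0 : (fun y ↦ S.φ y (S.ξ y)) = 0 := funext S.φ_ξ
  rw [S.covariantDerivativeφ_apply D v (S.contMDiff_ξ.mdifferentiableAt x), h0,
    CovariantDerivative.zero, hA]
  simp

/-- Differentiate g(φY, Z) = -g(Y, φZ). -/
lemma inner_covariantDerivativeφ_left [T2Space M] (hD : IsLeviCivita g D)
    (hS : IsCompatibleMetric S g) (x : M) (v w u : TangentSpace (𝓡 n) x) :
    g.inner x (S.covariantDerivativeφ D x v w) u =
      - g.inner x w (S.covariantDerivativeφ D x v u) := by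
  obtain ⟨Y, hY, rfl⟩ := exists_isSmoothField_apply_eq x w
  obtain ⟨Z, hZ, rfl⟩ := exists_isSmoothField_apply_eq x u
  have hY' := hY.mdifferentiableAt x
  have hZ' := hZ.mdifferentiableAt x
  have h1 := hD.metric _ _ x v (S.mdifferentiableAt_φ hY') hZ'
  have h2 := hD.metric _ _ x v hY' (S.mdifferentiableAt_φ hZ')
  simp_rw [hS.inner_φ_left, mvfderiv_fun_neg] at h1
  rw [neg_apply, h2] at h1
  rw [S.covariantDerivativeφ_apply D v hY', S.covariantDerivativeφ_apply D v hZ']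
  simp only [map_sub, sub_apply, hS.inner_φ_left]
  linarith

/-- Put f = φw and Q = ∇_vφ. Differentiating φ² = Id - η ⊗ ξ gives Qφf = -φQf modulo ξ, so g(Qφf, f)
= g(Qf, φf), while skewness of Q gives the opposite sign. -/
lemma inner_covariantDerivativeφ_φ_φ [T2Space M] (hD : IsLeviCivita g D)
    (hS : IsCompatibleMetric S g) (x : M) (v w : TangentSpace (𝓡 n) x) :
    g.inner x (S.covariantDerivativeφ D x v (S.φ x w)) (S.φ x (S.φ x w)) = 0 := by
  have h1 := hD.inner_covariantDerivativeφ_left hS x v (S.φ x (S.φ x w)) (S.φ x w)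
  obtain ⟨W, hW, rfl⟩ := exists_isSmoothField_apply_eq x w
  have hY := S.isSmoothField_φ hW
  have h0 : (fun y ↦ S.φ y (S.φ y (S.φ y (W y)))) = fun y ↦ S.φ y (W y) := by
    ext1 y
    rw [S.φ_φ, S.η_φ, zero_smul, sub_zero]
  have e1 := S.covariantDerivativeφ_apply D v (hY.mdifferentiableAt x)
  have e2 := S.covariantDerivativeφ_apply D v ((S.isSmoothField_φ hY).mdifferentiableAt x)
  have e3 : S.covariantDerivativeφ D x v (S.φ x (S.φ x (W x))) =
      - S.φ x (S.covariantDerivativeφ D x v (S.φ x (W x))) +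
        S.η x (D (fun y ↦ S.φ y (W y)) x v) • S.ξ x := by
    rw [e1, e2, h0, map_sub, S.φ_φ]
    abel
  rw [e3] at h1
  simp only [map_add, map_neg, map_smul, add_apply, neg_apply, smul_apply, hS.inner_φ_left,
    hS.inner_ξ_left, S.η_φ, smul_eq_mul, mul_zero, add_zero, neg_neg] at h1
  have h3 := g.symm x (S.φ x (S.φ x (W x))) (S.covariantDerivativeφ D x v (S.φ x (W x)))
  have h4 := hS.inner_φ_left x (S.φ x (W x)) (S.covariantDerivativeφ D x v (S.φ x (W x)))
  have h5 := hS.inner_φ_left x (W x) (S.φ x (S.covariantDerivativeφ D x v (S.φ x (W x))))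
  linarith

/-- In dimension three, `(∇_v φ) w = -g(φ² v, w) ξ + η(w) φ² v` as soon as `∇ξ = -φ`. -/
lemma covariantDerivativeφ_eq [T2Space M]
    (hn : n = 3) (hD : IsLeviCivita g D) (hS : IsCompatibleMetric S g)
    (hA : ∀ x v, D S.ξ x v = - S.φ x v) (x : M) (v w : TangentSpace (𝓡 n) x) :
    S.covariantDerivativeφ D x v w =
      - g.inner x (S.φ x (S.φ x v)) w • S.ξ x + S.η x w • S.φ x (S.φ x v) := by
  have hV : Module.finrank ℝ (TangentSpace (𝓡 n) x) = 3 := by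
    rw [← hn]
    exact finrank_euclideanSpace_fin
  have h := (hS.isParacontactForm x).skew_apply_eq hV
    (Q := (S.covariantDerivativeφ D x v).toLinearMap)
    (hD.inner_covariantDerivativeφ_left hS x v) (hD.inner_covariantDerivativeφ_φ_φ hS x v) w
  simp only [ContinuousLinearMap.coe_coe, covariantDerivativeφ_ξ hA] at h
  exact h

lemma nijenhuisTorsion_eq (hD : IsLeviCivita g D) (hX : IsSmoothField X) (hY : IsSmoothField Y)
    (x : M) :
    nijenhuisTorsion S.φ X Y x =
      S.covariantDerivativeφ D x (S.φ x (X x)) (Y x)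
        - S.covariantDerivativeφ D x (S.φ x (Y x)) (X x)
        + S.φ x (S.covariantDerivativeφ D x (Y x) (X x))
        - S.φ x (S.covariantDerivativeφ D x (X x) (Y x)) := by
  have hX' := hX.mdifferentiableAt x
  have hY' := hY.mdifferentiableAt x
  have hφX := S.mdifferentiableAt_φ hX'
  have hφY := S.mdifferentiableAt_φ hY'
  rw [nijenhuisTorsion, hD.mlieBracket_eq hX' hY', hD.mlieBracket_eq hφX hφY,
    hD.mlieBracket_eq hφX hY', hD.mlieBracket_eq hX' hφY]
  simp only [S.covariantDerivativeφ_apply D _ hX', S.covariantDerivativeφ_apply D _ hY', map_sub]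
  abel

lemma isNormal [T2Space M] (hn : n = 3) (hD : IsLeviCivita g D) (hS : IsParacontactMetric S g)
    (hA : ∀ x v, D S.ξ x v = - S.φ x v) : S.IsNormal := by
  intro X Y hX hY x
  have hc := hS.compatible
  rw [hD.nijenhuisTorsion_eq hX hY, ← hS.fundamentalForm_eq X Y hX hY]
  -- The terms in φ³X and φ³Y cancel; the ξ-component is g(φY, X) - g(φX, Y) = 2 g(X, φY).
  simp only [covariantDerivativeφ_eq hn hD hc hA, map_add, map_smul, S.φ_ξ, smul_zero, zero_add]
  simp only [S.φ_φ, map_sub, map_smul, S.φ_ξ, smul_zero, sub_zero,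
    hc.inner_φ_left, g.symm x (Y x) (S.φ x (X x))]
  module

end IsLeviCivita

end CovariantDerivativeOfEndomorphism

end

theorem mainTheorem7 {M : Type*} [TopologicalSpace M] [T2Space M]
    [ChartedSpace (EuclideanSpace ℝ (Fin 3)) M] [IsManifold (𝓡 3) ∞ M]
    (S : AlmostParacontactStructure 3 M) (g : PseudoRiemannianMetric 3 M)
    (hS : IsParacontactMetric S g)
    (D : AffineConnection 3 M) (hD : IsLeviCivita g D)
    (hξ : IsAffineKilling D S.ξ) :
    IsKilling g S.ξ ∧ IsParaSasakian S g :=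
  have hA := hD.covariantDerivative_ξ_of_isAffineKilling hS hξ
  ⟨hD.isKilling_of_covariantDerivative_ξ hS.compatible hA, hS, hD.isNormal rfl hS hA⟩
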